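/- Let $d\ge 1$ and write $|\cdot|$ for the Euclidean norm and $\mathcal L$ for Lebesgue measure on $\mathbb R^d$. **Stable allocations.** Let $S\subset\mathbb R^d$ be a set of centers, each center $\xi\in S$ having an appetite $\alpha_\xi\in[0,\infty)$. An allocation is a function $\psi:\mathbb R^d\to S\cup\{\infty,\Delta\}$ with $\mathcal L(\psi^{-1}(\Delta))=0$ such that every territory $\psi^{-1}(\xi)$, $\xi\in S$, is Lebesgue measurable with $\mathcal L(\psi^{-1}(\xi))\le\alpha_\xi$. A center $\xi$ is unsated if $\mathcal L(\psi^{-1}(\xi))<\alpha_\xi$. A site $x$ with $\psi(x)\notin\{\xi,\Delta\}$ desires the center $\xi$ if $\psi(x)=\infty$ or $|x-\xi|<|x-\psi(x)|$; the center $\xi$ covets $x$ if $\xi$ is unsated or $|x-\xi|<|x'-\xi|$ for some $x'\in\psi^{-1}(\xi)$. The allocation is stable if there is no pair $(x,\xi)$ such that $x$ desires $\xi$ and $\xi$ covets $x$. **The model.** Let $\Xi$ be a Poisson point process of intensity $1$ in $\mathbb R^d$, defined on a probability space $(\Omega_1,\mathbf P)$. Let $\alpha$ be a nonnegative random variable with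 finite variance and mean $\mu$, and let $\{\alpha(n,z): n\in\mathbb N, z\in\mathbb Z^d\}$ be i.i.d. copies of $\alpha$, defined on a probability space $(\Omega_2,P)$; write $\mathcal P=\mathbf P\times P$ and $\mathcal E$ for the corresponding expectation. The appetite of a center $\xi$ of a locally finite set $S$ is $\alpha_\xi=\alpha(n_0,z)$, where $n_0$ is the smallest $n\in\mathbb N=\{0,1,\dots\}$ such that the binary cube of order $n$ (a cube $\prod_i(z_i2^{-n},(z_i+1)2^{-n}]$ with $z\in\mathbb Z^d$) which contains $\xi$ contains no other point of $S$, and $z$ is the index of that cube for $n=n_0$. Thus, given the centers, the appetites are i.i.d. copies of $\alpha$. The Palm version $\Xi^*=\Xi\cup\{0\}$ is the Poisson process with an added center at the origin, its appetites being assigned by the same rule with $S=\Xi^*$; $\mathcal E^*$ denotes the expectation for this model. **Theorem.** (i) Let $d>1$ and $\mu>2^d$. Let $\psi$ be a random allocation which is almost surely a stable allocation to $\Xi$ with the appetites $(\alpha_\xi)_{\xi\in\Xi}$ and satisfies $\psi(0)\ne\Delta$ almost surely, and let $X=|\psi(0)|\in[0,\infty]$, with $X=\infty$ if $\psi(0)=\infty$.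 Then $\mathcal E\,X^{d-\delta}<\infty$ for every $\delta\in(0,d)$. (ii) Let $\alpha\le M$ almost surely for some constant $M$, and let $\mu<2^{-d}$. Then for every $\varepsilon\in(0,d/2)$ there is a constant $c>0$ such that $\mathcal E^*\exp\!\big(c\,(R^*)^{\varepsilon}\big)<\infty$ for every random allocation $\psi^*$ which is almost surely a stable allocation to $\Xi^*$ with the appetites $(\alpha_\xi)_{\xi\in\Xi^*}$, where $R^*=\operatorname{ess\,sup}_{x\in(\psi^*)^{-1}(0)}|x|\in[0,\infty]$ is the radius of the territory of the center at the origin (and $R^*=0$ if that territory is a null set). -/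

import Mathlib

open MeasureTheory ProbabilityTheory Set
open scoped NNReal ENNReal

noncomputable section

namespace PoissonAllocation

/-- The space of sites `ℝ^d` with the Euclidean norm and Lebesgue measure. -/
abbrev Site (d : ℕ) : Type := EuclideanSpace ℝ (Fin d)

/-! ### The Poisson process of centers -/

/-- The number of points of the set `S` in the region `B`. -/
def count {d : ℕ} (S B : Set (Site d)) : ℕ := (S ∩ B).ncard

/-- The random set `Ξ` of points of `ℝ^d` is a homogeneous (simple) Poisson point process of
intensity `lam`: it is almost surely locally finite, the number of points in a bounded Borel
set `B` is a Poisson random variable of mean `lam * vol B`, and the numbers of points in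
finitely many disjoint bounded Borel sets are independent. -/
structure IsPoissonProcess {d : ℕ} {Ω : Type*} [MeasurableSpace Ω] (P : Measure Ω)
    (lam : ℝ≥0) (Ξ : Ω → Set (Site d)) : Prop where
  locallyFinite : ∀ᵐ ω ∂P, ∀ B : Set (Site d), Bornology.IsBounded B → (Ξ ω ∩ B).Finite
  count_law : ∀ B : Set (Site d), MeasurableSet B → Bornology.IsBounded B →
    HasLaw (fun ω => count (Ξ ω) B) (poissonMeasure (lam * (volume B).toNNReal)) P
  count_indep : ∀ (m : ℕ) (B : Fin m → Set (Site d)),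
    (∀ i, MeasurableSet (B i)) → (∀ i, Bornology.IsBounded (B i)) →
    Pairwise (fun i j => Disjoint (B i) (B j)) →
    iIndepFun (fun i ω => count (Ξ ω) (B i)) P

/-! ### The appetites, attached to the centers through binary cubes -/

/-- The binary cube of order `n` with index `z`,
i.e. the product of the intervals `(z_i 2^{-n}, (z_i + 1) 2^{-n}]`. -/
def binaryCube {d : ℕ} (n : ℕ) (z : Fin d → ℤ) : Set (Site d) :=
  {x | ∀ i, (z i : ℝ) / 2 ^ n < x i ∧ x i ≤ ((z i : ℝ) + 1) / 2 ^ n}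

/-- The index of the unique binary cube of order `n` that contains `x`. -/
def cubeIndex {d : ℕ} (n : ℕ) (x : Site d) : Fin d → ℤ := fun i => ⌈2 ^ n * x i⌉ - 1

theorem mem_binaryCube_iff {d : ℕ} (n : ℕ) (z : Fin d → ℤ) (x : Site d) :
    x ∈ binaryCube n z ↔ z = cubeIndex n x := by
  have h2 : (0 : ℝ) < 2 ^ n := by positivity
  have key : ∀ i, ((z i : ℝ) / 2 ^ n < x i ∧ x i ≤ ((z i : ℝ) + 1) / 2 ^ n) ↔
      z i = ⌈2 ^ n * x i⌉ - 1 := by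
    intro i
    rw [div_lt_iff₀ h2, le_div_iff₀ h2, eq_sub_iff_add_eq, eq_comm (a := z i + 1),
      Int.ceil_eq_iff, mul_comm (x i)]
    push_cast
    simp
  constructor
  · intro h
    funext i
    exact (key i).1 (h i)
  · intro h i
    exact (key i).2 (congrFun h i)

/-- For a center `ξ` of the set of centers `S`: the smallest `n` such that the binary cube of
order `n` that contains `ξ` contains no other center. -/
def isolationOrder {d : ℕ} (S : Set (Site d)) (ξ : Site d) : ℕ :=
  sInf {n : ℕ | S ∩ binaryCube n (cubeIndex n ξ) ⊆ {ξ}}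

/-- The appetite of the center `ξ` of the set of centers `S`, read off from the marks `a`
of the binary cubes: the mark of the largest binary cube in which `ξ` is the only center. -/
def appetite {d : ℕ} (a : ℕ × (Fin d → ℤ) → ℝ≥0) (S : Set (Site d)) (ξ : Site d) : ℝ≥0 :=
  a (isolationOrder S ξ, cubeIndex (isolationOrder S ξ) ξ)

/-- The marks `a k` of the binary cubes are independent random variables of the same law `ν`. -/
structure IsIIDMarks {d : ℕ} {Ω : Type*} [MeasurableSpace Ω] (P : Measure Ω)
    (ν : Measure ℝ≥0) (a : ℕ × (Fin d → ℤ) → Ω → ℝ≥0) : Prop where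
  law : ∀ k, HasLaw (a k) ν P
  indep : iIndepFun a P

/-! ### Allocations and stability -/

/-- The possible values of an allocation: a center `ξ`, the symbol `∞` for an unclaimed site,
or the symbol `Δ` for the sites of the exceptional null set. -/
inductive Target (d : ℕ) : Type
  | center (ξ : Site d) : Target d
  | infinity : Target d
  | exceptional : Target d

/-- The territory of `ξ` is the set of the sites which are allocated to `ξ`. -/
def territory {d : ℕ} (ψ : Site d → Target d) (ξ : Site d) : Set (Site d) :=
  {x | ψ x = Target.center ξ}

/-- `ψ` is an allocation to the set of centers `S` with appetites `α`. -/
structure IsAllocation {d : ℕ} (S : Set (Site d)) (α : Site d → ℝ≥0)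
    (ψ : Site d → Target d) : Prop where
  center_mem : ∀ x ξ, ψ x = Target.center ξ → ξ ∈ S
  measurable_territory : ∀ ξ ∈ S, NullMeasurableSet (territory ψ ξ) volume
  exceptional_null : volume {x | ψ x = Target.exceptional} = 0
  territory_le : ∀ ξ ∈ S, volume (territory ψ ξ) ≤ α ξ

/-- A center is unsated if the volume of its territory is smaller than its appetite. -/
def Unsated {d : ℕ} (α : Site d → ℝ≥0) (ψ : Site d → Target d) (ξ : Site d) : Prop :=
  volume (territory ψ ξ) < α ξ

/-- The site `x` desires the center `ξ`: it is neither exceptional nor allocated to `ξ`, and it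
is unclaimed or allocated to a center which is farther away than `ξ`. -/
def Desires {d : ℕ} (ψ : Site d → Target d) (x ξ : Site d) : Prop :=
  ψ x ≠ Target.center ξ ∧ ψ x ≠ Target.exceptional ∧
    (ψ x = Target.infinity ∨ ∃ η, ψ x = Target.center η ∧ dist x ξ < dist x η)

/-- The center `ξ` covets the site `x`: it is unsated, or its territory has a site which is
farther away from `ξ` than `x`. -/
def Covets {d : ℕ} (α : Site d → ℝ≥0) (ψ : Site d → Target d) (ξ x : Site d) : Prop :=
  (∃ y ∈ territory ψ ξ, dist x ξ < dist y ξ) ∨ Unsated α ψ ξ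

/-- `ψ` is a stable allocation to the set of centers `S` with appetites `α`:
there is no unstable pair of a site and a center. -/
structure IsStableAllocation {d : ℕ} (S : Set (Site d)) (α : Site d → ℝ≥0)
    (ψ : Site d → Target d) : Prop extends IsAllocation S α ψ where
  stable : ∀ x, ∀ ξ ∈ S, ¬ (Desires ψ x ξ ∧ Covets α ψ ξ x)

/-! ### The two quantities of interest -/

/-- The distance `|x - ψ(x)|` in `[0, ∞]` of a site to its center; it is `∞` for an unclaimed
site (and for an exceptional site, where the distance has no meaning). -/
def siteDistance {d : ℕ} (ψ : Site d → Target d) (x : Site d) : ℝ≥0∞ :=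
  match ψ x with
  | Target.center ξ => edist x ξ
  | Target.infinity => ⊤
  | Target.exceptional => ⊤

/-- The radius in `[0, ∞]` of the territory of `ξ`:
the essential supremum of `|ξ - x|` over the sites `x` of the territory. -/
def radius {d : ℕ} (ψ : Site d → Target d) (ξ : Site d) : ℝ≥0∞ :=
  essSup (fun x => edist ξ x) (volume.restrict (territory ψ ξ))

/-- The set of centers of the Palm version of a Poisson process: a center is added at the
origin. -/
def palmCenters {d : ℕ} (S : Set (Site d)) : Set (Site d) := insert 0 S

end PoissonAllocation

end

/-!
Both bounds come from comparing the total appetite of the centers in a ball with a volume.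

Supercritical case. If the origin is not served within distance `r`, it desires every center in
`B(0, r)`, so by stability none of them covets it: they are all sated, with territories inside
`B(0, 2r)` (`sum_appetite_le_volume_ball`). Their total appetite is therefore at most
`2 ^ d * vol B(0, r)`, whereas its mean is `μ * vol B(0, r)` with `μ > 2 ^ d`. Its variance is
of order `r ^ d`, so Chebyshev's inequality gives a tail of order `r ^ (-d)`.

Subcritical case. If the territory of the center at the origin reaches beyond distance `r`, that
center covets every site of `B(0, r)`, so by stability almost all these sites are served by
centers in `B(0, 2r)` (`volume_ball_le_sum_appetite`). The total appetite of the latter is then at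
least `vol B(0, r)`, whereas its mean is about `2 ^ d * μ * vol B(0, r)` with `2 ^ d * μ < 1`. The
appetites being bounded, a Chernoff bound gives a tail of order `exp (-κ * r ^ d)`; exponents up
to `d` are within reach of this argument.

Given the centers, the appetites of finitely many centers are marks of distinct cubes
(`exists_sum_appetite_eq`), so that the two tail bounds are first proved conditionally on the
centers, as functions of the Poisson number of centers in the ball, and then averaged. The
allocation is not assumed to depend measurably on the randomness; `lintegral_prod_le_tsum` passes
from conditional tail bounds to the expectation without measurability.
-/

namespace PoissonAllocation

/-! ### Volumes of balls -/

/-- The volume of the unit ball of `ℝ^d`. -/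
noncomputable def unitBallVolume (d : ℕ) : ℝ := (volume (Metric.ball (0 : Site d) 1)).toReal

theorem unitBallVolume_pos (d : ℕ) : 0 < unitBallVolume d :=
  ENNReal.toReal_pos (Metric.measure_ball_pos volume _ one_pos).ne' measure_ball_lt_top.ne

theorem volume_ball {d : ℕ} {r : ℝ} (hr : 0 < r) :
    volume (Metric.ball (0 : Site d) r) = ENNReal.ofReal (r ^ d * unitBallVolume d) := by
  rw [Measure.addHaar_ball_of_pos volume 0 hr, finrank_euclideanSpace_fin,
    ENNReal.ofReal_mul (by positivity), unitBallVolume,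
    ENNReal.ofReal_toReal measure_ball_lt_top.ne]

/-! ### Appetites as sums of distinct marks -/

theorem abs_sub_lt_of_mem_binaryCube {d : ℕ} {n : ℕ} {ξ η : Site d}
    (h : η ∈ binaryCube n (cubeIndex n ξ)) (i : Fin d) : |η i - ξ i| < 1 / 2 ^ n := by
  have hξ : ξ ∈ binaryCube n (cubeIndex n ξ) := (mem_binaryCube_iff _ _ _).2 rfl
  have h1 := h i
  have h2 := hξ i
  rw [add_div] at h1 h2
  rw [abs_lt]
  constructor <;> linarith [h1.1, h1.2, h2.1, h2.2]

/-- All the binary cubes that contain a given point lie in one bounded set. -/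
theorem isBounded_iUnion_binaryCube {d : ℕ} (ξ : Site d) :
    Bornology.IsBounded (⋃ n, binaryCube n (cubeIndex n ξ)) := by
  refine (Metric.isBounded_closedBall (x := ξ) (r := √d)).subset ?_
  intro η hη
  obtain ⟨n, hn⟩ := mem_iUnion.1 hη
  rw [Metric.mem_closedBall, EuclideanSpace.dist_eq]
  apply Real.sqrt_le_sqrt
  calc ∑ i, dist (η i) (ξ i) ^ 2 ≤ ∑ _i : Fin d, (1 : ℝ) := by
        refine Finset.sum_le_sum fun i _ => ?_
        have h1 := (abs_sub_lt_of_mem_binaryCube hn i).le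
        have h2 : (1 : ℝ) / 2 ^ n ≤ 1 := by
          rw [div_le_one (by positivity)]
          exact one_le_pow₀ (by norm_num)
        rw [Real.dist_eq]
        exact pow_le_one₀ (abs_nonneg _) (h1.trans h2)
    _ = d := by simp

/-- In a locally finite set of centers, every point is eventually isolated by its binary cubes,
so that `isolationOrder` is an infimum over a nonempty set. -/
theorem inter_binaryCube_isolationOrder_subset {d : ℕ} {S : Set (Site d)}
    (hS : ∀ B : Set (Site d), Bornology.IsBounded B → (S ∩ B).Finite) (ξ : Site d) :
    S ∩ binaryCube (isolationOrder S ξ) (cubeIndex (isolationOrder S ξ) ξ) ⊆ {ξ} := by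
  suffices h : {n : ℕ | S ∩ binaryCube n (cubeIndex n ξ) ⊆ {ξ}}.Nonempty from Nat.sInf_mem h
  have hfin := hS _ (isBounded_iUnion_binaryCube ξ)
  have hev : ∀ η ∈ S ∩ ⋃ n, binaryCube n (cubeIndex n ξ), ∀ᶠ n : ℕ in Filter.atTop,
      η ∈ binaryCube n (cubeIndex n ξ) → η = ξ := by
    intro η _
    by_cases hne : η = ξ
    · exact Filter.Eventually.of_forall fun _ _ => hne
    obtain ⟨i, hi⟩ : ∃ i, η i ≠ ξ i := by
      by_contra! hcon
      exact hne (PiLp.ext hcon)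
    have hpos : 0 < |η i - ξ i| := abs_pos.2 (sub_ne_zero.2 hi)
    have hlim : Filter.Tendsto (fun n : ℕ => (1 / 2 : ℝ) ^ n) Filter.atTop (nhds 0) :=
      tendsto_pow_atTop_nhds_zero_of_lt_one (by norm_num) (by norm_num)
    filter_upwards [hlim.eventually (gt_mem_nhds hpos)] with n hn hmem
    have := abs_sub_lt_of_mem_binaryCube hmem i
    rw [one_div_pow] at hn
    linarith
  obtain ⟨n, hn⟩ := ((Filter.eventually_all_finite hfin).2 hev).exists
  exact ⟨n, fun η hη => hn η ⟨hη.1, mem_iUnion.2 ⟨n, hη.2⟩⟩ hη.2⟩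

/-- Distinct centers read off the marks of distinct cubes, so that the total appetite of finitely
many centers is the sum of as many of the independent marks. -/
theorem exists_sum_appetite_eq {d : ℕ} {S : Set (Site d)}
    (hS : ∀ B : Set (Site d), Bornology.IsBounded B → (S ∩ B).Finite)
    (F : Finset (Site d)) (hF : (F : Set (Site d)) ⊆ S) :
    ∃ K : Finset (ℕ × (Fin d → ℤ)), K.card = F.card ∧
      ∀ a : ℕ × (Fin d → ℤ) → ℝ≥0, ∑ ξ ∈ F, appetite a S ξ = ∑ k ∈ K, a k := by
  classical
  have hinj : Set.InjOn (fun ξ => (isolationOrder S ξ, cubeIndex (isolationOrder S ξ) ξ))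
      (F : Set (Site d)) := by
    intro ξ hξ η hη h
    obtain ⟨h1, h2⟩ := Prod.mk.inj h
    have hmem : ξ ∈ binaryCube (isolationOrder S η) (cubeIndex (isolationOrder S η) η) := by
      rw [mem_binaryCube_iff, ← h2, h1]
    exact inter_binaryCube_isolationOrder_subset hS η ⟨hF hξ, hmem⟩
  refine ⟨F.image _, Finset.card_image_of_injOn hinj, fun a => ?_⟩
  rw [Finset.sum_image hinj]
  rfl

/-! ### The geometry of stable allocations -/

/-- If the origin is not served within distance `r`, then no center in `B(0, r)` covets it. Such a
center is sated, and its territory lies in `B(0, 2r)`. -/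
theorem sum_appetite_le_volume_ball {d : ℕ} {S : Set (Site d)} {α : Site d → ℝ≥0}
    {ψ : Site d → Target d} (h : IsStableAllocation S α ψ) (h0 : ψ 0 ≠ Target.exceptional)
    {r : ℝ} (hr : ENNReal.ofReal r < siteDistance ψ 0) (F : Finset (Site d))
    (hFS : (F : Set (Site d)) ⊆ S) (hFr : (F : Set (Site d)) ⊆ Metric.ball 0 r) :
    ((∑ ξ ∈ F, α ξ : ℝ≥0) : ℝ≥0∞) ≤ volume (Metric.ball (0 : Site d) (2 * r)) := by
  have hdes : ∀ ξ ∈ F, Desires ψ 0 ξ := by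
    intro ξ hξ
    have hd : dist (0 : Site d) ξ < r := by
      rw [dist_comm]
      exact hFr hξ
    unfold siteDistance at hr
    unfold Desires
    cases hψ : ψ 0 with
    | center η =>
      simp only [hψ, edist_dist] at hr
      have hη : r < dist 0 η := (ENNReal.ofReal_lt_ofReal_iff'.1 hr).1
      refine ⟨?_, by simp, Or.inr ⟨η, rfl, hd.trans hη⟩⟩
      rintro h
      cases h
      linarith
    | infinity => simp
    | exceptional => exact absurd hψ h0
  have hcov : ∀ ξ ∈ F, ¬ Covets α ψ ξ 0 := fun ξ hξ hc => h.stable 0 ξ (hFS hξ) ⟨hdes ξ hξ, hc⟩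
  have hsub : ∀ ξ ∈ F, territory ψ ξ ⊆ Metric.ball 0 (2 * r) := by
    intro ξ hξ y hy
    have h1 : dist y ξ ≤ dist 0 ξ := by
      by_contra! hlt
      exact hcov ξ hξ (Or.inl ⟨y, hy, hlt⟩)
    have h2 : dist ξ 0 < r := hFr hξ
    rw [Metric.mem_ball]
    linarith [dist_triangle y ξ 0, dist_comm ξ 0]
  have hvol : ∀ ξ ∈ F, (α ξ : ℝ≥0∞) ≤ volume (territory ψ ξ) := by
    intro ξ hξ
    by_contra! hlt
    exact hcov ξ hξ (Or.inr hlt)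
  calc ((∑ ξ ∈ F, α ξ : ℝ≥0) : ℝ≥0∞) = ∑ ξ ∈ F, (α ξ : ℝ≥0∞) := by push_cast; rfl
    _ ≤ ∑ ξ ∈ F, volume (territory ψ ξ) := Finset.sum_le_sum hvol
    _ = volume (⋃ ξ ∈ F, territory ψ ξ) := by
        refine (measure_biUnion_finset₀ ?_ fun ξ hξ => h.measurable_territory ξ (hFS hξ)).symm
        intro ξ _ η _ hne
        refine Disjoint.aedisjoint (Set.disjoint_left.2 fun x hx hy => hne ?_)
        exact Target.center.inj (Eq.trans (Eq.symm hx) hy)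
    _ ≤ _ := measure_mono (iUnion₂_subset hsub)

/-- If the territory of a center at the origin reaches beyond `B(0, r)`, then that center covets
every site of `B(0, r)`, so each non-exceptional one of them is served by a center in
`B(0, 2r)`. -/
theorem volume_ball_le_sum_appetite {d : ℕ} {S : Set (Site d)} {α : Site d → ℝ≥0}
    {ψ : Site d → Target d} (h : IsStableAllocation S α ψ) (h0 : (0 : Site d) ∈ S)
    {r : ℝ} (hr : ENNReal.ofReal r < radius ψ 0) (F : Finset (Site d))
    (hFS : (F : Set (Site d)) ⊆ S) (hF : S ∩ Metric.ball 0 (2 * r) ⊆ F) :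
    volume (Metric.ball (0 : Site d) r) ≤ ((∑ ξ ∈ F, α ξ : ℝ≥0) : ℝ≥0∞) := by
  have hnull : NullMeasurableSet (territory ψ 0) volume := h.measurable_territory 0 h0
  obtain ⟨y, hy, hyr⟩ : ∃ y ∈ territory ψ 0, ENNReal.ofReal r < edist 0 y := by
    by_contra! hcon
    refine hr.not_ge (essSup_le_of_ae_le _ ?_)
    filter_upwards [ae_restrict_mem₀ hnull] with x hx using hcon x hx
  have hyr' : r < dist y 0 := by
    rw [edist_dist, dist_comm] at hyr
    exact (ENNReal.ofReal_lt_ofReal_iff'.1 hyr).1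
  have hcover : Metric.ball (0 : Site d) r ⊆
      (⋃ ξ ∈ F, territory ψ ξ) ∪ {x | ψ x = Target.exceptional} := by
    intro x hx
    have hx0 : dist x 0 < r := hx
    have hcov : Covets α ψ 0 x := Or.inl ⟨y, hy, hx0.trans hyr'⟩
    have hnd : ¬ Desires ψ x 0 := fun hd => h.stable x 0 h0 ⟨hd, hcov⟩
    have hr0 : 0 < r := dist_nonneg.trans_lt hx0
    unfold Desires at hnd
    cases hψ : ψ x with
    | center η =>
      refine Or.inl (mem_iUnion₂.2 ⟨η, hF ⟨h.center_mem x η hψ, ?_⟩, hψ⟩)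
      by_cases hη : η = 0
      · subst hη
        simpa using hr0
      have h1 : dist x η ≤ dist x 0 := by
        by_contra! hlt
        exact hnd ⟨by rw [hψ]; simpa using hη, by simp [hψ], Or.inr ⟨η, hψ, hlt⟩⟩
      rw [Metric.mem_ball]
      linarith [dist_triangle η x 0, dist_comm η x]
    | infinity => exact absurd ⟨by simp [hψ], by simp [hψ], Or.inl hψ⟩ hnd
    | exceptional => exact Or.inr hψ
  calc volume (Metric.ball (0 : Site d) r)
      ≤ volume (⋃ ξ ∈ F, territory ψ ξ) + volume {x | ψ x = Target.exceptional} :=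
        (measure_mono hcover).trans (measure_union_le _ _)
    _ = volume (⋃ ξ ∈ F, territory ψ ξ) := by rw [h.exceptional_null, add_zero]
    _ ≤ ∑ ξ ∈ F, volume (territory ψ ξ) := measure_biUnion_finset_le _ _
    _ ≤ ∑ ξ ∈ F, (α ξ : ℝ≥0∞) := Finset.sum_le_sum fun ξ hξ => h.territory_le ξ (hFS hξ)
    _ = _ := by push_cast; rfl

/-! ### Moments of the Poisson distribution -/

theorem lintegral_ofReal_poissonMeasure {r : ℝ≥0} {f : ℕ → ℝ} (hf : ∀ n, 0 ≤ f n) {s : ℝ}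
    (h : HasSum (fun n => Real.exp (-r) * r ^ n / n.factorial * f n) s) :
    ∫⁻ n, ENNReal.ofReal (f n) ∂poissonMeasure r = ENNReal.ofReal s := by
  rw [lintegral_countable', ← h.tsum_eq,
    ENNReal.ofReal_tsum_of_nonneg (fun n => mul_nonneg (by positivity) (hf n)) h.summable]
  refine tsum_congr fun n => ?_
  rw [poissonMeasure_singleton, ENNReal.ofReal_mul (by positivity), mul_comm]

/-- The probability generating function of the Poisson distribution. -/
theorem hasSum_poisson_exp (r x : ℝ) :
    HasSum (fun n : ℕ => Real.exp (-r) * r ^ n / n.factorial * x ^ n)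
      (Real.exp (r * (x - 1))) := by
  have h := (NormedSpace.expSeries_div_hasSum_exp (r * x)).mul_left (Real.exp (-r))
  rw [← Real.exp_eq_exp_ℝ, ← Real.exp_add] at h
  convert! h using 1
  · funext n
    rw [mul_pow]
    ring
  · ring_nf

theorem hasSum_poisson_mean (r : ℝ) :
    HasSum (fun n : ℕ => Real.exp (-r) * r ^ n / n.factorial * n) r := by
  have h := (hasSum_poisson_exp r 1).mul_left r
  rw [← hasSum_nat_add_iff' 1]
  convert! h using 1
  · funext n
    rw [Nat.factorial_succ]
    push_cast
    field_simp
    ring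
  · simp

theorem hasSum_poisson_sq (r : ℝ) :
    HasSum (fun n : ℕ => Real.exp (-r) * r ^ n / n.factorial * (n : ℝ) ^ 2) (r ^ 2 + r) := by
  have h := ((hasSum_poisson_mean r).add (hasSum_poisson_exp r 1)).mul_left r
  rw [← hasSum_nat_add_iff' 1]
  convert! h using 1
  · funext n
    rw [Nat.factorial_succ]
    push_cast
    field_simp
    ring
  · simp
    ring

/-- The value at a Poisson number `n` of the bound in Chebyshev's inequality for a sum of `n` terms
of mean `m` and variance `s`, averaged over `n`. -/
theorem hasSum_poisson_second_moment (r s m : ℝ) :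
    HasSum (fun n : ℕ => Real.exp (-r) * r ^ n / n.factorial * (s * n + (m * n - m * r) ^ 2))
      ((s + m ^ 2) * r) := by
  have h0 : HasSum (fun n : ℕ => Real.exp (-r) * r ^ n / n.factorial) 1 := by
    simpa using hasSum_poisson_exp r 1
  have h := (((hasSum_poisson_mean r).mul_left (s - 2 * m ^ 2 * r)).add
    ((hasSum_poisson_sq r).mul_left (m ^ 2))).add (h0.mul_left (m ^ 2 * r ^ 2))
  convert! h using 1
  · funext n
    ring
  · ring

/-! ### Sums of independent marks -/

section Marks

variable {d : ℕ} {Ω : Type*} [MeasurableSpace Ω] {P : Measure Ω} {ν : Measure ℝ≥0}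
  {a : ℕ × (Fin d → ℤ) → Ω → ℝ≥0}

theorem IsIIDMarks.iIndepFun_coe (ha : IsIIDMarks P ν a) :
    iIndepFun (fun k ω => (a k ω : ℝ)) P :=
  ha.indep.comp (fun _ => ((↑) : ℝ≥0 → ℝ)) fun _ => measurable_coe_nnreal_real

/-- Chebyshev's inequality for a sum of marks, centered at a value `c` that need not be the
mean of the sum: taking for `c` the mean over a Poisson number of marks covers the fluctuations of
the marks and of their number at once. -/
theorem IsIIDMarks.measure_sum_le [IsProbabilityMeasure P] (ha : IsIIDMarks P ν a)
    (hvar : MemLp (fun t : ℝ≥0 => (t : ℝ)) 2 ν) (K : Finset (ℕ × (Fin d → ℤ)))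
    {b c : ℝ} (hbc : b < c) :
    P {ω | ∑ k ∈ K, (a k ω : ℝ) ≤ b} ≤
      ENNReal.ofReal (variance (fun t : ℝ≥0 => (t : ℝ)) ν * K.card +
        ((∫ t : ℝ≥0, (t : ℝ) ∂ν) * K.card - c) ^ 2) / ENNReal.ofReal ((c - b) ^ 2) := by
  set m := ∫ t : ℝ≥0, (t : ℝ) ∂ν with hm
  set s := variance (fun t : ℝ≥0 => (t : ℝ)) ν with hs
  have hLp : ∀ k, MemLp (fun ω => (a k ω : ℝ)) 2 P := by
    intro k
    have := hvar
    rw [← (ha.law k).map_eq] at this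
    exact (memLp_map_measure_iff this.aestronglyMeasurable (ha.law k).aemeasurable).1 this
  have hmean : ∀ k, ∫ ω, (a k ω : ℝ) ∂P = m := fun k =>
    (ha.law k).integral_comp hvar.aestronglyMeasurable
  have hvark : ∀ k, variance (fun ω => (a k ω : ℝ)) P = s := by
    intro k
    have h1 := (ha.law k).map_eq
    rw [hs, ← h1, variance_map (by rw [h1]; exact hvar.aestronglyMeasurable.aemeasurable)
      (ha.law k).aemeasurable]
    rfl
  set Y : Ω → ℝ := ∑ k ∈ K, fun ω => (a k ω : ℝ) with hY
  have hYLp : MemLp Y 2 P := memLp_finsetSum' _ fun k _ => hLp k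
  have hYmean : ∫ ω, Y ω ∂P = m * K.card := by
    simp only [hY, Finset.sum_apply]
    rw [integral_finsetSum _ fun k _ => (hLp k).integrable one_le_two]
    simp [hmean, mul_comm]
  have hYvar : variance Y P = s * K.card := by
    rw [hY, IndepFun.variance_sum (fun k _ => hLp k)
      (fun i _ j _ hij => ha.iIndepFun_coe.indepFun hij)]
    simp [hvark, mul_comm]
  have hsq : ∫ ω, (Y ω - c) ^ 2 ∂P = s * K.card + (m * K.card - c) ^ 2 := by
    have h1 : MemLp (fun ω => Y ω - c) 2 P := hYLp.sub (memLp_const c)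
    have h2 := variance_eq_sub h1
    rw [variance_sub_const hYLp.aestronglyMeasurable, hYvar,
      integral_sub (hYLp.integrable one_le_two) (integrable_const c), hYmean] at h2
    simp only [Pi.pow_apply, integral_const, probReal_univ, smul_eq_mul, one_mul] at h2
    linarith
  have hint : Integrable (fun ω => (Y ω - c) ^ 2) P := (hYLp.sub (memLp_const c)).integrable_sq
  have hpos : 0 < (c - b) ^ 2 := by
    have : 0 < c - b := by linarith
    positivity
  calc P {ω | ∑ k ∈ K, (a k ω : ℝ) ≤ b}
      ≤ P {ω | ENNReal.ofReal ((c - b) ^ 2) ≤ ENNReal.ofReal ((Y ω - c) ^ 2)} := by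
        refine measure_mono fun ω hω => ENNReal.ofReal_le_ofReal ?_
        have : Y ω ≤ b := by simpa [hY] using hω
        nlinarith
    _ ≤ (∫⁻ ω, ENNReal.ofReal ((Y ω - c) ^ 2) ∂P) / ENNReal.ofReal ((c - b) ^ 2) :=
        meas_ge_le_lintegral_div hint.aestronglyMeasurable.aemeasurable.ennreal_ofReal
          (by simpa only [ne_eq, ENNReal.ofReal_eq_zero, not_le] using hpos) ENNReal.ofReal_ne_top
    _ = _ := by
        rw [← ofReal_integral_eq_lintegral_ofReal hint (ae_of_all _ fun _ => sq_nonneg _), hsq]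

theorem integrable_exp_mul_of_ae_le [IsProbabilityMeasure ν] {M : ℝ}
    (hM : ∀ᵐ (t : ℝ≥0) ∂ν, (t : ℝ) ≤ M) {u : ℝ} (hu : 0 ≤ u) :
    Integrable (fun t : ℝ≥0 => Real.exp (u * t)) ν := by
  refine Integrable.of_bound (by fun_prop) (Real.exp (u * M)) ?_
  filter_upwards [hM] with t ht
  rw [Real.norm_of_nonneg (Real.exp_pos _).le]
  gcongr

/-- The Chernoff bound for a sum of bounded marks. -/
theorem IsIIDMarks.measure_le_sum [IsProbabilityMeasure P] [IsProbabilityMeasure ν]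
    (ha : IsIIDMarks P ν a) {M : ℝ} (hM : ∀ᵐ (t : ℝ≥0) ∂ν, (t : ℝ) ≤ M)
    (K : Finset (ℕ × (Fin d → ℤ))) {u : ℝ} (hu : 0 ≤ u) (b : ℝ) :
    P {ω | b ≤ ∑ k ∈ K, (a k ω : ℝ)} ≤
      ENNReal.ofReal (Real.exp (-u * b) * (∫ t : ℝ≥0, Real.exp (u * t) ∂ν) ^ K.card) := by
  have hint := integrable_exp_mul_of_ae_le hM hu
  have hmeas : ∀ k, AEMeasurable (fun ω => (a k ω : ℝ)) P := fun k =>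
    (ha.law k).aemeasurable.coe_nnreal_real
  have hintk : ∀ k, Integrable (fun ω => Real.exp (u * (a k ω : ℝ))) P := by
    intro k
    have := hint
    rw [← (ha.law k).map_eq] at this
    exact (integrable_map_measure this.aestronglyMeasurable (ha.law k).aemeasurable).1 this
  have hmgfk : ∀ k, mgf (fun ω => (a k ω : ℝ)) P u = ∫ t : ℝ≥0, Real.exp (u * t) ∂ν := fun k =>
    (ha.law k).integral_comp hint.aestronglyMeasurable
  have hmgf := ha.iIndepFun_coe.mgf_sum₀ (t := u) hmeas K
  have hintsum : Integrable
      (fun ω => Real.exp (u * (∑ k ∈ K, fun ω => (a k ω : ℝ)) ω)) P := by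
    have h1 : ∀ᵐ ω ∂P, ∀ k ∈ K, (a k ω : ℝ) ≤ M := by
      rw [Finset.eventually_all]
      intro k _
      exact ((ha.law k).ae_iff (p := fun t : ℝ≥0 => (t : ℝ) ≤ M)
        (measurableSet_setOfPred.1 (measurableSet_le (by fun_prop) (by fun_prop)))).2 hM
    refine Integrable.of_bound ?_ (Real.exp (u * (K.card * M))) ?_
    · have : AEMeasurable (∑ k ∈ K, fun ω => (a k ω : ℝ)) P :=
        Finset.aemeasurable_sum _ fun k _ => hmeas k
      exact (this.const_mul u).exp.aestronglyMeasurable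
    · filter_upwards [h1] with ω hω
      rw [Real.norm_of_nonneg (Real.exp_pos _).le, Finset.sum_apply]
      gcongr
      simpa using Finset.sum_le_card_nsmul K (fun k => (a k ω : ℝ)) M hω
  have h := measure_ge_le_exp_mul_mgf (μ := P) b hu hintsum
  rw [hmgf] at h
  simp only [hmgfk, Finset.prod_const, Finset.sum_apply] at h
  exact ENNReal.le_ofReal_iff_toReal_le (measure_ne_top _ _) (by
    have : 0 ≤ ∫ t : ℝ≥0, Real.exp (u * t) ∂ν := integral_nonneg fun _ => (Real.exp_pos _).le
    positivity) |>.2 h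

theorem one_le_integral_exp_mul [IsProbabilityMeasure ν] {M : ℝ}
    (hM : ∀ᵐ (t : ℝ≥0) ∂ν, (t : ℝ) ≤ M) {u : ℝ} (hu : 0 ≤ u) :
    1 ≤ ∫ t : ℝ≥0, Real.exp (u * t) ∂ν := by
  calc (1 : ℝ) = ∫ _t : ℝ≥0, (1 : ℝ) ∂ν := by simp
    _ ≤ _ := integral_mono (integrable_const _) (integrable_exp_mul_of_ae_le hM hu)
        fun t => Real.one_le_exp (by positivity)

/-- In the subcritical regime the exponential rate of the Chernoff bound is positive for small
parameters: the moment generating function is `1 + u * mean + O(u ^ 2)`. -/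
theorem exists_mul_integral_exp_sub_one_lt [IsProbabilityMeasure ν] {M : ℝ}
    (hM : ∀ᵐ (t : ℝ≥0) ∂ν, (t : ℝ) ≤ M) {D : ℝ} (hD : 0 < D)
    (hmean : ∫ t : ℝ≥0, (t : ℝ) ∂ν < D⁻¹) :
    ∃ u : ℝ, 0 < u ∧ D * ((∫ t : ℝ≥0, Real.exp (u * t) ∂ν) - 1) < u := by
  set m := ∫ t : ℝ≥0, (t : ℝ) ∂ν with hm
  set L := |M| + 1 with hL
  have hL0 : 0 < L := by positivity
  have hgap : 0 < 1 - D * m := by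
    have := mul_lt_mul_of_pos_left hmean hD
    rw [mul_inv_cancel₀ hD.ne'] at this
    linarith
  set u := min (1 / L) ((1 - D * m) / (2 * D * L ^ 2)) with hu
  have hu0 : 0 < u := lt_min (by positivity) (by positivity)
  have hu1 : u * L ≤ 1 := by
    calc u * L ≤ 1 / L * L := by gcongr; exact min_le_left _ _
      _ = 1 := by field_simp
  have hu2 : D * (u * L ^ 2) < 1 - D * m := by
    calc D * (u * L ^ 2) ≤ D * ((1 - D * m) / (2 * D * L ^ 2) * L ^ 2) := by
          gcongr; exact min_le_right _ _
      _ = (1 - D * m) / 2 := by field_simp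
      _ < 1 - D * m := by linarith
  refine ⟨u, hu0, ?_⟩
  have hid : Integrable (fun t : ℝ≥0 => (t : ℝ)) ν := by
    refine Integrable.of_bound (by fun_prop) M ?_
    filter_upwards [hM] with t ht
    simpa using ht
  have hle : ∫ t : ℝ≥0, Real.exp (u * t) ∂ν ≤ ∫ t : ℝ≥0, (1 + u * t + (u * L) ^ 2) ∂ν := by
    refine integral_mono_ae (integrable_exp_mul_of_ae_le hM hu0.le)
      (((integrable_const _).add (hid.const_mul u)).add (integrable_const _)) ?_
    filter_upwards [hM] with t ht
    have htL : (t : ℝ) ≤ L := ht.trans ((le_abs_self M).trans (by linarith))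
    have h1 : u * t ≤ u * L := by gcongr
    have h0 : 0 ≤ u * (t : ℝ) := by positivity
    have h2 := (abs_le.1 (Real.abs_exp_sub_one_sub_id_le (x := u * t)
      (by rw [abs_of_nonneg h0]; linarith))).2
    have h3 : (u * (t : ℝ)) ^ 2 ≤ (u * L) ^ 2 := by gcongr
    show Real.exp (u * t) ≤ 1 + u * t + (u * L) ^ 2
    linarith
  have hval : ∫ t : ℝ≥0, (1 + u * t + (u * L) ^ 2) ∂ν = 1 + u * m + (u * L) ^ 2 := by
    have h1 : Integrable (fun t : ℝ≥0 => 1 + u * (t : ℝ)) ν :=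
      (integrable_const _).add (hid.const_mul u)
    rw [integral_add h1 (integrable_const _),
      integral_add (integrable_const _) (hid.const_mul u), integral_const_mul]
    simp [hm]
  rw [hval] at hle
  calc D * ((∫ t : ℝ≥0, Real.exp (u * t) ∂ν) - 1) ≤ D * (u * m + (u * L) ^ 2) := by
        gcongr; linarith
    _ = u * (D * m + D * (u * L ^ 2)) := by ring
    _ < u * 1 := by gcongr; linarith
    _ = u := mul_one u

end Marks

/-! ### Expectations from conditional tail bounds -/

theorem le_add_tsum_dyadic {φ : ℝ≥0∞ → ℝ≥0∞} (hφ : Monotone φ) (h1 : 1 ≤ φ 1) (x : ℝ≥0∞) :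
    φ x ≤ φ 1 + ∑' n : ℕ, φ (2 ^ (n + 1)) * {y | (2 : ℝ≥0∞) ^ n < y}.indicator 1 x := by
  classical
  rcases eq_or_ne x ⊤ with rfl | hx
  · have : ∑' n : ℕ, φ (2 ^ (n + 1)) * {y | (2 : ℝ≥0∞) ^ n < y}.indicator 1 ⊤ = ⊤ := by
      refine top_unique ((ENNReal.tsum_const_eq_top_of_ne_zero (α := ℕ) one_ne_zero).symm.le.trans
        (ENNReal.tsum_le_tsum fun n => ?_))
      rw [indicator_of_mem (by simp)]
      simpa using h1.trans (hφ (one_le_pow₀ one_le_two))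
    rw [this, add_top]
    exact le_top
  have hex : ∃ m : ℕ, x ≤ 2 ^ m := by
    lift x to ℝ≥0 using hx
    obtain ⟨m, hm⟩ := pow_unbounded_of_one_lt x (one_lt_two)
    exact ⟨m, by exact_mod_cast hm.le⟩
  have hspec := Nat.find_spec hex
  have hmin := fun m => Nat.find_min (m := m) hex
  rcases hN : Nat.find hex with _ | n
  · rw [hN, pow_zero] at hspec
    exact (hφ hspec).trans le_self_add
  · rw [hN] at hspec
    have hn : (2 : ℝ≥0∞) ^ n < x := not_le.1 (hmin n (by omega))
    calc φ x ≤ φ (2 ^ (n + 1)) := hφ hspec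
      _ = φ (2 ^ (n + 1)) * {y | (2 : ℝ≥0∞) ^ n < y}.indicator 1 x := by
          rw [indicator_of_mem (by simpa using hn)]
          simp
      _ ≤ _ := ENNReal.le_tsum n
      _ ≤ _ := le_add_self

/-- The layer-cake estimate on a product space, from bounds on the conditional tail
probabilities. Neither `X` nor its sections need be measurable: the integral of `X` is a lower
integral, and the sections of the tail events are replaced by measurable hulls. -/
theorem lintegral_prod_le_tsum {Ω₁ Ω₂ : Type*} [MeasurableSpace Ω₁] [MeasurableSpace Ω₂]
    {P₁ : Measure Ω₁} [IsProbabilityMeasure P₁] {P₂ : Measure Ω₂} [IsProbabilityMeasure P₂]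
    {φ : ℝ≥0∞ → ℝ≥0∞} (hφ : Monotone φ) (h1 : 1 ≤ φ 1) {X : Ω₁ × Ω₂ → ℝ≥0∞}
    {g : ℕ → Ω₁ → ℝ≥0∞} (hg : ∀ n, AEMeasurable (g n) P₁)
    (hX : ∀ n, ∀ᵐ ω₁ ∂P₁, P₂ {ω₂ | 2 ^ n < X (ω₁, ω₂)} ≤ g n ω₁) :
    ∫⁻ ω, φ (X ω) ∂(P₁.prod P₂) ≤ φ 1 + ∑' n : ℕ, φ (2 ^ (n + 1)) * ∫⁻ ω₁, g n ω₁ ∂P₁ := by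
  have hinner : ∀ᵐ ω₁ ∂P₁, ∫⁻ ω₂, φ (X (ω₁, ω₂)) ∂P₂ ≤
      φ 1 + ∑' n : ℕ, φ (2 ^ (n + 1)) * g n ω₁ := by
    filter_upwards [ae_all_iff.2 hX] with ω₁ hω₁
    set T : ℕ → Set Ω₂ := fun n => toMeasurable P₂ {ω₂ | 2 ^ n < X (ω₁, ω₂)} with hT
    have hTm : ∀ n, MeasurableSet (T n) := fun n => measurableSet_toMeasurable _ _
    have hTind : ∀ n, Measurable ((T n).indicator (1 : Ω₂ → ℝ≥0∞)) := fun n =>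
      measurable_one.indicator (hTm n)
    calc ∫⁻ ω₂, φ (X (ω₁, ω₂)) ∂P₂
        ≤ ∫⁻ ω₂, (φ 1 + ∑' n : ℕ, φ (2 ^ (n + 1)) * (T n).indicator 1 ω₂) ∂P₂ := by
          refine lintegral_mono fun ω₂ => (le_add_tsum_dyadic hφ h1 _).trans ?_
          gcongr with n
          by_cases hω : 2 ^ n < X (ω₁, ω₂)
          · rw [indicator_of_mem (by simpa using hω),
              indicator_of_mem (subset_toMeasurable P₂ _ hω)]
            rfl
          · rw [indicator_of_notMem (by simpa using hω)]
            exact zero_le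
      _ = φ 1 + ∑' n : ℕ, φ (2 ^ (n + 1)) * P₂ {ω₂ | 2 ^ n < X (ω₁, ω₂)} := by
          rw [lintegral_add_left measurable_const, lintegral_const, measure_univ, mul_one,
            lintegral_tsum fun n => ((hTind n).const_mul _).aemeasurable]
          congr 1
          refine tsum_congr fun n => ?_
          rw [lintegral_const_mul _ (hTind n), lintegral_indicator_one (hTm n),
            measure_toMeasurable]
      _ ≤ _ := by
          gcongr with n
          exact hω₁ n
  calc ∫⁻ ω, φ (X ω) ∂(P₁.prod P₂) ≤ ∫⁻ ω₁, ∫⁻ ω₂, φ (X (ω₁, ω₂)) ∂P₂ ∂P₁ :=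
        lintegral_prod_le _
    _ ≤ ∫⁻ ω₁, (φ 1 + ∑' n : ℕ, φ (2 ^ (n + 1)) * g n ω₁) ∂P₁ := lintegral_mono_ae hinner
    _ = _ := by
        rw [lintegral_add_left measurable_const, lintegral_const, measure_univ, mul_one,
          lintegral_tsum fun n => (hg n).const_mul _]
        congr 1
        exact tsum_congr fun n => lintegral_const_mul'' _ (hg n)

theorem IsPoissonProcess.lintegral_count_ball {d : ℕ} {Ω : Type*} [MeasurableSpace Ω]
    {P : Measure Ω} {Ξ : Ω → Set (Site d)} (hΞ : IsPoissonProcess P 1 Ξ) {r : ℝ} (hr : 0 < r)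
    {f : ℕ → ℝ} (hf : ∀ n, 0 ≤ f n) {s : ℝ}
    (h : HasSum (fun n => Real.exp (-(r ^ d * unitBallVolume d)) *
      (r ^ d * unitBallVolume d) ^ n / n.factorial * f n) s) :
    ∫⁻ ω, ENNReal.ofReal (f (count (Ξ ω) (Metric.ball 0 r))) ∂P = ENNReal.ofReal s := by
  have hlaw := hΞ.count_law (Metric.ball 0 r) measurableSet_ball Metric.isBounded_ball
  rw [hlaw.lintegral_comp (f := fun n => ENNReal.ofReal (f n)) .of_discrete]
  refine lintegral_ofReal_poissonMeasure hf ?_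
  have hv := (unitBallVolume_pos d).le
  have hcoe : ((1 * (volume (Metric.ball (0 : Site d) r)).toNNReal : ℝ≥0) : ℝ) =
      r ^ d * unitBallVolume d := by
    rw [one_mul, ENNReal.coe_toNNReal_eq_toReal, volume_ball hr,
      ENNReal.toReal_ofReal (by positivity)]
  rw [hcoe]
  exact h

theorem IsPoissonProcess.aemeasurable_count_ball {d : ℕ} {Ω : Type*} [MeasurableSpace Ω]
    {P : Measure Ω} {Ξ : Ω → Set (Site d)} (hΞ : IsPoissonProcess P 1 Ξ) (r : ℝ)
    (f : ℕ → ℝ≥0∞) : AEMeasurable (fun ω => f (count (Ξ ω) (Metric.ball 0 r))) P :=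
  (measurable_of_countable f).comp_aemeasurable
    (hΞ.count_law (Metric.ball 0 r) measurableSet_ball Metric.isBounded_ball).aemeasurable

section Model

variable {d : ℕ} {Ω₁ Ω₂ : Type*} [MeasurableSpace Ω₁] [MeasurableSpace Ω₂]
  {P₁ : Measure Ω₁} {P₂ : Measure Ω₂} [IsProbabilityMeasure P₂]
  {Ξ : Ω₁ → Set (Site d)} {ν : Measure ℝ≥0}
  {a : ℕ × (Fin d → ℤ) → Ω₂ → ℝ≥0}

/-! ### The supercritical regime -/

/-- Given the centers, the site at the origin is served beyond distance `r` only if the total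
appetite in `B(0, r)` falls below `2 ^ d` times its volume; the right-hand side is the resulting
Chebyshev bound. -/
theorem measure_lt_siteDistance_le (hΞ : IsPoissonProcess P₁ 1 Ξ)
    (hvar : MemLp (fun t : ℝ≥0 => (t : ℝ)) 2 ν) (ha : IsIIDMarks P₂ ν a)
    (hmean : (2 : ℝ) ^ d < ∫ t : ℝ≥0, (t : ℝ) ∂ν)
    {ψ : Ω₁ × Ω₂ → Site d → Target d}
    (hψ : ∀ᵐ ω ∂(P₁.prod P₂), IsStableAllocation (Ξ ω.1)
      (appetite (fun k => a k ω.2) (Ξ ω.1)) (ψ ω))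
    (hψ0 : ∀ᵐ ω ∂(P₁.prod P₂), ψ ω 0 ≠ Target.exceptional) {r : ℝ} (hr : 0 < r) :
    ∀ᵐ ω₁ ∂P₁, P₂ {ω₂ | ENNReal.ofReal r < siteDistance (ψ (ω₁, ω₂)) 0} ≤
      ENNReal.ofReal (variance (fun t : ℝ≥0 => (t : ℝ)) ν * count (Ξ ω₁) (Metric.ball 0 r) +
        ((∫ t : ℝ≥0, (t : ℝ) ∂ν) * count (Ξ ω₁) (Metric.ball 0 r) -
          (∫ t : ℝ≥0, (t : ℝ) ∂ν) * (r ^ d * unitBallVolume d)) ^ 2) /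
      ENNReal.ofReal ((((∫ t : ℝ≥0, (t : ℝ) ∂ν) - 2 ^ d) * (r ^ d * unitBallVolume d)) ^ 2) := by
  set m := ∫ t : ℝ≥0, (t : ℝ) ∂ν with hm
  have hV : 0 < r ^ d * unitBallVolume d := mul_pos (by positivity) (unitBallVolume_pos d)
  filter_upwards [hΞ.locallyFinite, Measure.ae_ae_of_ae_prod (hψ.and hψ0)] with ω₁ hlf hst
  have hfin := hlf (Metric.ball 0 r) Metric.isBounded_ball
  obtain ⟨K, hK, hsum⟩ := exists_sum_appetite_eq hlf hfin.toFinset (by simp)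
  have hKc : K.card = count (Ξ ω₁) (Metric.ball 0 r) := by
    rw [hK, count, Set.ncard_eq_toFinset_card _ hfin]
  have hbc : 2 ^ d * (r ^ d * unitBallVolume d) < m * (r ^ d * unitBallVolume d) := by
    gcongr
  have hcheb := ha.measure_sum_le hvar K hbc
  rw [← sub_mul, hKc] at hcheb
  refine (measure_mono_ae ?_).trans hcheb
  filter_upwards [hst] with ω₂ hω₂ hdist
  have h := sum_appetite_le_volume_ball hω₂.1 hω₂.2 hdist hfin.toFinset (by simp) (by simp)
  rw [hsum, volume_ball (by positivity), ENNReal.ofReal, ENNReal.coe_le_coe,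
    Real.le_toNNReal_iff_coe_le (by have := unitBallVolume_pos d; positivity)] at h
  push_cast at h
  calc ∑ k ∈ K, (a k ω₂ : ℝ) ≤ (2 * r) ^ d * unitBallVolume d := h
    _ = _ := by rw [mul_pow, mul_assoc]

/-- In the supercritical regime the distance from the origin to its center has a tail of order
`r ^ (-d)`, hence finite moments of every order below `d`. -/
theorem lintegral_siteDistance_rpow_lt_top [IsProbabilityMeasure P₁]
    (hΞ : IsPoissonProcess P₁ 1 Ξ)
    (hvar : MemLp (fun t : ℝ≥0 => (t : ℝ)) 2 ν) (ha : IsIIDMarks P₂ ν a)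
    (hmean : (2 : ℝ) ^ d < ∫ t : ℝ≥0, (t : ℝ) ∂ν)
    {ψ : Ω₁ × Ω₂ → Site d → Target d}
    (hψ : ∀ᵐ ω ∂(P₁.prod P₂), IsStableAllocation (Ξ ω.1)
      (appetite (fun k => a k ω.2) (Ξ ω.1)) (ψ ω))
    (hψ0 : ∀ᵐ ω ∂(P₁.prod P₂), ψ ω 0 ≠ Target.exceptional)
    {p : ℝ} (hp0 : 0 ≤ p) (hpd : p < d) :
    ∫⁻ ω, siteDistance (ψ ω) 0 ^ p ∂(P₁.prod P₂) < ∞ := by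
  set m := ∫ t : ℝ≥0, (t : ℝ) ∂ν with hm
  set s := variance (fun t : ℝ≥0 => (t : ℝ)) ν with hs
  have hs0 : 0 ≤ s := variance_nonneg _ _
  have hv := unitBallVolume_pos d
  have hpow : ∀ n : ℕ, ENNReal.ofReal ((2 : ℝ) ^ n) = 2 ^ n := fun n => by
    rw [ENNReal.ofReal_pow zero_le_two, ENNReal.ofReal_ofNat]
  have hφ : Monotone fun x : ℝ≥0∞ => x ^ p := ENNReal.monotone_rpow_of_nonneg hp0
  refine (lintegral_prod_le_tsum hφ (by simp)
    (g := fun n ω₁ => ENNReal.ofReal (s * count (Ξ ω₁) (Metric.ball 0 (2 ^ n)) +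
        (m * count (Ξ ω₁) (Metric.ball 0 (2 ^ n)) -
          m * ((2 ^ n) ^ d * unitBallVolume d)) ^ 2) /
      ENNReal.ofReal (((m - 2 ^ d) * ((2 ^ n) ^ d * unitBallVolume d)) ^ 2))
    (fun n => hΞ.aemeasurable_count_ball (2 ^ n) (fun N => ENNReal.ofReal (s * N +
      (m * N - m * ((2 ^ n) ^ d * unitBallVolume d)) ^ 2) / _)) (fun n => ?_)).trans_lt ?_
  · have h := measure_lt_siteDistance_le hΞ hvar ha hmean hψ hψ0 (r := 2 ^ n) (by positivity)
    rwa [hpow] at h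
  have hgap : 0 < m - 2 ^ d := by linarith
  have hint : ∀ n : ℕ, ((2 : ℝ≥0∞) ^ (n + 1)) ^ p *
      ∫⁻ ω₁, ENNReal.ofReal (s * count (Ξ ω₁) (Metric.ball 0 (2 ^ n)) +
        (m * count (Ξ ω₁) (Metric.ball 0 (2 ^ n)) -
          m * ((2 ^ n) ^ d * unitBallVolume d)) ^ 2) /
      ENNReal.ofReal (((m - 2 ^ d) * ((2 ^ n) ^ d * unitBallVolume d)) ^ 2) ∂P₁ =
      ENNReal.ofReal (2 ^ p * (s + m ^ 2) / ((m - 2 ^ d) ^ 2 * unitBallVolume d) *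
        (2 ^ p / 2 ^ d) ^ n) := by
    intro n
    have hpow' : ((2 : ℝ≥0∞) ^ (n + 1)) ^ p = ENNReal.ofReal ((2 ^ p) ^ (n + 1)) := by
      rw [← hpow, ENNReal.ofReal_rpow_of_nonneg (by positivity) hp0,
        Real.rpow_pow_comm zero_le_two]
    simp_rw [div_eq_mul_inv (ENNReal.ofReal _)]
    rw [lintegral_mul_const'' _ (hΞ.aemeasurable_count_ball (2 ^ n)
        (fun N => ENNReal.ofReal (s * N + (m * N - m * ((2 ^ n) ^ d * unitBallVolume d)) ^ 2))),
      hΞ.lintegral_count_ball (by positivity)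
        (f := fun N => s * N + (m * N - m * ((2 ^ n) ^ d * unitBallVolume d)) ^ 2)
        (fun N => by positivity) (hasSum_poisson_second_moment _ s m), hpow',
      ← ENNReal.ofReal_inv_of_pos (by positivity), ← ENNReal.ofReal_mul (by positivity),
      ← ENNReal.ofReal_mul (by positivity)]
    congr 1
    have h2 : ((2 : ℝ) ^ n) ^ d = (2 ^ d) ^ n := by rw [← pow_mul, ← pow_mul, mul_comm]
    rw [h2, div_pow, pow_succ]
    field_simp
  have hq : (2 : ℝ) ^ p / 2 ^ d < 1 := by
    rw [div_lt_one (by positivity), ← Real.rpow_natCast]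
    exact Real.rpow_lt_rpow_of_exponent_lt one_lt_two hpd
  have hsummable : Summable fun n : ℕ =>
      2 ^ p * (s + m ^ 2) / ((m - 2 ^ d) ^ 2 * unitBallVolume d) * ((2 : ℝ) ^ p / 2 ^ d) ^ n :=
    (summable_geometric_of_lt_one (by positivity) hq).mul_left _
  rw [tsum_congr hint, ENNReal.one_rpow]
  exact ENNReal.add_lt_top.2 ⟨ENNReal.one_lt_top, hsummable.tsum_ofReal_lt_top⟩

/-! ### The subcritical regime -/

/-- Given the centers, the territory of the added center reaches beyond distance `r` only if the
total appetite in `B(0, 2 * r)` is at least the volume of `B(0, r)`; the right-hand side is the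
resulting Chernoff bound, the extra factor being due to the added center. -/
theorem measure_lt_radius_le [IsProbabilityMeasure ν] (hΞ : IsPoissonProcess P₁ 1 Ξ)
    (ha : IsIIDMarks P₂ ν a) {M : ℝ} (hM : ∀ᵐ (t : ℝ≥0) ∂ν, (t : ℝ) ≤ M)
    {ψ : Ω₁ × Ω₂ → Site d → Target d}
    (hψ : ∀ᵐ ω ∂(P₁.prod P₂), IsStableAllocation (palmCenters (Ξ ω.1))
      (appetite (fun k => a k ω.2) (palmCenters (Ξ ω.1))) (ψ ω))
    {u : ℝ} (hu : 0 ≤ u) {r : ℝ} (hr : 0 < r) :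
    ∀ᵐ ω₁ ∂P₁, P₂ {ω₂ | ENNReal.ofReal r < radius (ψ (ω₁, ω₂)) 0} ≤
      ENNReal.ofReal (Real.exp (-u * (r ^ d * unitBallVolume d)) *
        (∫ t : ℝ≥0, Real.exp (u * t) ∂ν) ^ (count (Ξ ω₁) (Metric.ball 0 (2 * r)) + 1)) := by
  filter_upwards [hΞ.locallyFinite, Measure.ae_ae_of_ae_prod hψ] with ω₁ hlf hst
  have hlf' : ∀ B : Set (Site d), Bornology.IsBounded B → (palmCenters (Ξ ω₁) ∩ B).Finite :=
    fun B hB => ((hlf B hB).insert 0).subset fun x hx =>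
      hx.1.imp id fun h => ⟨h, hx.2⟩
  have hfin := hlf' (Metric.ball 0 (2 * r)) Metric.isBounded_ball
  obtain ⟨K, hK, hsum⟩ := exists_sum_appetite_eq hlf' hfin.toFinset (by simp)
  have hKc : K.card ≤ count (Ξ ω₁) (Metric.ball 0 (2 * r)) + 1 := by
    rw [hK, count, ← Set.ncard_eq_toFinset_card _ hfin]
    refine (Set.ncard_le_ncard (fun x hx => ?_)
      ((hlf _ Metric.isBounded_ball).insert (0 : Site d))).trans (Set.ncard_insert_le _ _)
    exact hx.1.imp id fun h => ⟨h, hx.2⟩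
  have hone := one_le_integral_exp_mul hM hu
  calc P₂ {ω₂ | ENNReal.ofReal r < radius (ψ (ω₁, ω₂)) 0}
      ≤ P₂ {ω₂ | r ^ d * unitBallVolume d ≤ ∑ k ∈ K, (a k ω₂ : ℝ)} := by
        refine measure_mono_ae ?_
        filter_upwards [hst] with ω₂ hω₂ hrad
        have h := volume_ball_le_sum_appetite hω₂ (mem_insert _ _) hrad hfin.toFinset (by simp)
          (by simp)
        rw [hsum, volume_ball hr, ENNReal.ofReal, ENNReal.coe_le_coe,
          Real.toNNReal_le_iff_le_coe] at h
        push_cast at h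
        exact h
    _ ≤ _ := ha.measure_le_sum hM K hu _
    _ ≤ _ := by gcongr

/-- In the subcritical regime the radius of the territory of the added center has a tail of order
`exp (-κ * r ^ d)`, hence a finite exponential moment of its `p`-th power for every `p ≤ d`. -/
theorem exists_lintegral_exp_radius_rpow_lt_top [IsProbabilityMeasure P₁]
    [IsProbabilityMeasure ν] (hd : 1 ≤ d) (hΞ : IsPoissonProcess P₁ 1 Ξ)
    (ha : IsIIDMarks P₂ ν a) {M : ℝ} (hM : ∀ᵐ (t : ℝ≥0) ∂ν, (t : ℝ) ≤ M)
    (hmean : ∫ t : ℝ≥0, (t : ℝ) ∂ν < ((2 : ℝ) ^ d)⁻¹)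
    {p : ℝ} (hp0 : 0 ≤ p) (hpd : p ≤ d) :
    ∃ c : ℝ≥0, 0 < c ∧ ∀ ψ : Ω₁ × Ω₂ → Site d → Target d,
      (∀ᵐ ω ∂(P₁.prod P₂), IsStableAllocation (palmCenters (Ξ ω.1))
        (appetite (fun k => a k ω.2) (palmCenters (Ξ ω.1))) (ψ ω)) →
      ∫⁻ ω, EReal.exp ((c * radius (ψ ω) 0 ^ p : ℝ≥0∞) : EReal) ∂(P₁.prod P₂) < ∞ := by
  have hv := unitBallVolume_pos d
  obtain ⟨u, hu, hκ⟩ := exists_mul_integral_exp_sub_one_lt hM (by positivity) hmean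
  set L := ∫ t : ℝ≥0, Real.exp (u * t) ∂ν with hL
  have hL1 : 1 ≤ L := one_le_integral_exp_mul hM hu.le
  set κ := (u - 2 ^ d * (L - 1)) * unitBallVolume d with hκdef
  have hκ0 : 0 < κ := mul_pos (by linarith) hv
  -- The factor `2 ^ d` absorbs the passage from the radius `2 ^ n` to `2 ^ (n + 1)`.
  refine ⟨⟨κ / (2 * 2 ^ d), by positivity⟩,
    NNReal.coe_pos.1 (show 0 < κ / (2 * 2 ^ d) by positivity), fun ψ hψ => ?_⟩
  set c : ℝ≥0 := ⟨κ / (2 * 2 ^ d), by positivity⟩ with hc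
  have hpow : ∀ n : ℕ, ENNReal.ofReal ((2 : ℝ) ^ n) = 2 ^ n := fun n => by
    rw [ENNReal.ofReal_pow zero_le_two, ENNReal.ofReal_ofNat]
  have hφ : Monotone fun x : ℝ≥0∞ => EReal.exp ((c * x ^ p : ℝ≥0∞) : EReal) := by
    intro x y hxy
    refine EReal.exp_monotone (EReal.coe_ennreal_le_coe_ennreal_iff.2 ?_)
    gcongr
  have hφval : ∀ x : ℝ, 0 ≤ x → EReal.exp ((c * ENNReal.ofReal x ^ p : ℝ≥0∞) : EReal) =
      ENNReal.ofReal (Real.exp (κ / (2 * 2 ^ d) * x ^ p)) := by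
    intro x hx
    have h1 : (c : ℝ≥0∞) = ENNReal.ofReal (κ / (2 * 2 ^ d)) :=
      (ENNReal.ofReal_coe_nnreal (p := c)).symm
    rw [h1, ENNReal.ofReal_rpow_of_nonneg hx hp0, ← ENNReal.ofReal_mul (by positivity),
      EReal.coe_ennreal_ofReal, max_eq_left (by positivity), EReal.exp_coe]
  refine (lintegral_prod_le_tsum hφ
    (EReal.one_le_exp_iff.2 (EReal.coe_ennreal_nonneg _))
    (g := fun n ω₁ => ENNReal.ofReal (Real.exp (-u * ((2 ^ n) ^ d * unitBallVolume d)) *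
      L ^ (count (Ξ ω₁) (Metric.ball 0 (2 * 2 ^ n)) + 1)))
    (fun n => hΞ.aemeasurable_count_ball (2 * 2 ^ n) (fun N => ENNReal.ofReal
      (Real.exp (-u * ((2 ^ n) ^ d * unitBallVolume d)) * L ^ (N + 1)))) (fun n => ?_)).trans_lt ?_
  · have h := measure_lt_radius_le hΞ ha hM hψ hu.le (r := 2 ^ n) (by positivity)
    rwa [hpow] at h
  have hint : ∀ n : ℕ, ∫⁻ ω₁, ENNReal.ofReal
      (Real.exp (-u * ((2 ^ n) ^ d * unitBallVolume d)) *
        L ^ (count (Ξ ω₁) (Metric.ball 0 (2 * 2 ^ n)) + 1)) ∂P₁ =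
      ENNReal.ofReal (L * Real.exp (-κ * (2 ^ n) ^ d)) := by
    intro n
    refine hΞ.lintegral_count_ball (by positivity)
      (f := fun N => Real.exp (-u * ((2 ^ n) ^ d * unitBallVolume d)) * L ^ (N + 1))
      (fun N => by positivity) ?_
    have h := (hasSum_poisson_exp ((2 * 2 ^ n) ^ d * unitBallVolume d) L).mul_left
      (L * Real.exp (-u * ((2 ^ n) ^ d * unitBallVolume d)))
    convert! h using 1
    · funext N
      ring
    · rw [mul_assoc, ← Real.exp_add]
      congr 2
      rw [hκdef, mul_pow]
      ring
  have hterm : ∀ n : ℕ, EReal.exp ((c * ((2 : ℝ≥0∞) ^ (n + 1)) ^ p : ℝ≥0∞) : EReal) *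
      ∫⁻ ω₁, ENNReal.ofReal (Real.exp (-u * ((2 ^ n) ^ d * unitBallVolume d)) *
        L ^ (count (Ξ ω₁) (Metric.ball 0 (2 * 2 ^ n)) + 1)) ∂P₁ ≤
      ENNReal.ofReal (L * Real.exp (-(κ / 2)) ^ n) := by
    intro n
    rw [hint, ← hpow, hφval _ (by positivity), ← ENNReal.ofReal_mul (by positivity)]
    refine ENNReal.ofReal_le_ofReal ?_
    rw [mul_left_comm, ← Real.exp_add, ← Real.exp_nat_mul]
    gcongr
    have h1 : ((2 : ℝ) ^ (n + 1)) ^ p ≤ 2 ^ d * (2 ^ n) ^ d := by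
      calc ((2 : ℝ) ^ (n + 1)) ^ p ≤ ((2 : ℝ) ^ (n + 1)) ^ (d : ℝ) :=
            Real.rpow_le_rpow_of_exponent_le (one_le_pow₀ one_le_two) hpd
        _ = 2 ^ d * (2 ^ n) ^ d := by rw [Real.rpow_natCast, pow_succ, mul_pow, mul_comm]
    have h2 : (n : ℝ) ≤ (2 ^ n) ^ d := by
      calc (n : ℝ) ≤ 2 ^ n := by exact_mod_cast (Nat.lt_two_pow_self (n := n)).le
        _ ≤ (2 ^ n) ^ d := le_self_pow₀ (one_le_pow₀ one_le_two) (by omega)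
    calc κ / (2 * 2 ^ d) * ((2 : ℝ) ^ (n + 1)) ^ p + -κ * (2 ^ n) ^ d
        ≤ κ / (2 * 2 ^ d) * (2 ^ d * (2 ^ n) ^ d) + -κ * (2 ^ n) ^ d := by gcongr
      _ = -(κ / 2) * (2 ^ n) ^ d := by
          field_simp
          ring
      _ ≤ n * -(κ / 2) := by nlinarith
  have hsummable : Summable fun n : ℕ => L * Real.exp (-(κ / 2)) ^ n :=
    (summable_geometric_of_lt_one (Real.exp_pos _).le
      (Real.exp_lt_one_iff.2 (by linarith))).mul_left _
  refine ENNReal.add_lt_top.2 ⟨?_, (ENNReal.tsum_le_tsum hterm).trans_lt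
    hsummable.tsum_ofReal_lt_top⟩
  have h := hφval 1 zero_le_one
  rw [ENNReal.ofReal_one] at h
  simp only [h]
  exact ENNReal.ofReal_lt_top

end Model

end PoissonAllocation

theorem mainTheorem1 {d : ℕ} {Ω₁ Ω₂ : Type*} [MeasurableSpace Ω₁] [MeasurableSpace Ω₂]
    (P₁ : Measure Ω₁) [IsProbabilityMeasure P₁] (P₂ : Measure Ω₂) [IsProbabilityMeasure P₂]
    (Ξ : Ω₁ → Set (PoissonAllocation.Site d))
    (hΞ : PoissonAllocation.IsPoissonProcess P₁ 1 Ξ)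
    (ν : Measure ℝ≥0) [IsProbabilityMeasure ν]
    (hvar : MemLp (fun t : ℝ≥0 => (t : ℝ)) 2 ν)
    (a : ℕ × (Fin d → ℤ) → Ω₂ → ℝ≥0)
    (ha : PoissonAllocation.IsIIDMarks P₂ ν a) :
    -- part (i)
    (1 < d → (2 : ℝ) ^ d < ∫ t : ℝ≥0, (t : ℝ) ∂ν →
      ∀ ψ : Ω₁ × Ω₂ → PoissonAllocation.Site d → PoissonAllocation.Target d,
        (∀ᵐ ω ∂(P₁.prod P₂), PoissonAllocation.IsStableAllocation (Ξ ω.1)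
          (PoissonAllocation.appetite (fun k => a k ω.2) (Ξ ω.1)) (ψ ω)) →
        (∀ᵐ ω ∂(P₁.prod P₂), ψ ω 0 ≠ PoissonAllocation.Target.exceptional) →
        ∀ δ ∈ Ioo (0 : ℝ) d,
          ∫⁻ ω, PoissonAllocation.siteDistance (ψ ω) 0 ^ ((d : ℝ) - δ) ∂(P₁.prod P₂) < ∞) ∧
    -- part (ii)
    (∀ M : ℝ, (∀ᵐ (t : ℝ≥0) ∂ν, (t : ℝ) ≤ M) → ∫ t : ℝ≥0, (t : ℝ) ∂ν < ((2 : ℝ) ^ d)⁻¹ →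
      ∀ ε ∈ Ioo (0 : ℝ) ((d : ℝ) / 2), ∃ c : ℝ≥0, 0 < c ∧
        ∀ ψ : Ω₁ × Ω₂ → PoissonAllocation.Site d → PoissonAllocation.Target d,
          (∀ᵐ ω ∂(P₁.prod P₂), PoissonAllocation.IsStableAllocation
            (PoissonAllocation.palmCenters (Ξ ω.1))
            (PoissonAllocation.appetite (fun k => a k ω.2)
              (PoissonAllocation.palmCenters (Ξ ω.1))) (ψ ω)) →
          ∫⁻ ω, EReal.exp ((c * PoissonAllocation.radius (ψ ω) 0 ^ ε : ℝ≥0∞) : EReal)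
            ∂(P₁.prod P₂) < ∞) := by
  refine ⟨fun _ hmean ψ hψ hψ0 δ hδ => ?_, fun M hM hmean ε hε => ?_⟩
  · exact PoissonAllocation.lintegral_siteDistance_rpow_lt_top hΞ hvar ha hmean hψ hψ0
      (by linarith [hδ.2]) (by linarith [hδ.1])
  · have hd : (0 : ℝ) < d := by linarith [hε.1, hε.2]
    exact PoissonAllocation.exists_lintegral_exp_radius_rpow_lt_top
      (Nat.one_le_iff_ne_zero.2 (by rintro rfl; simp at hd)) hΞ ha hM hmean hε.1.le
      (by linarith [hε.1, hε.2])
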